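/- Let $R$ be a $3$-dimensional regular local ring whose maximal ideal $\mathfrak m$ is generated by $x, y, z$. Let $I$ be the ideal of $R$ generated by the maximal ($2\times 2$) minors of the matrix $$\begin{pmatrix} x & y & z \\ y & z & x^2 \end{pmatrix}.$$ For $n \ge 1$ let $I^{(n)} = \bigcap_{\mathfrak p} (I^n R_{\mathfrak p} \cap R)$ be the $n$-th symbolic power of $I$, where $\mathfrak p$ runs over the minimal prime ideals of $I$ and $I^n R_{\mathfrak p} \cap R$ denotes the preimage of $I^n R_{\mathfrak p}$ in $R$. Then for every integer $n \ge 1$, with $q = \lfloor n/2 \rfloor$, $$\operatorname{depth}_R R/(I^n :_R \mathfrak m^q) > 0 \quad\text{and}\quad I^{(n)} = I^n :_R \mathfrak m^q .$$ -/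

import Mathlib

/-- The ideal generated by the `t × t` minors of a matrix `A` (rows and columns of each
submatrix are kept in increasing order). -/
def minorsIdeal {R : Type*} [CommRing R] {m n : ℕ} (t : ℕ) (A : Matrix (Fin m) (Fin n) R) :
    Ideal R :=
  Ideal.span {d : R | ∃ (r : Fin t ↪o Fin m) (c : Fin t ↪o Fin n), d = (A.submatrix r c).det}

/-- The `n`-th symbolic power of `I`: the intersection, over the minimal primes `p` of `R ⧸ I`,
of the contractions to `R` of `I ^ n R_p`. -/
def symbolicPower {R : Type*} [CommRing R] (I : Ideal R) (n : ℕ) : Ideal R :=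
  ⨅ (p : PrimeSpectrum R) (_ : p.asIdeal ∈ I.minimalPrimes),
    ((I ^ n).map (algebraMap R (Localization.AtPrime p.asIdeal))).comap
      (algebraMap R (Localization.AtPrime p.asIdeal))

open Classical in
/-- The depth of a module `M` over a local ring `(R, 𝔪)`: the supremum of the lengths of the
`M`-regular sequences contained in `𝔪`, with the usual convention that the depth is `∞` if
`𝔪 M = M` (for finitely generated `M`, if `M = 0`). -/
noncomputable def localDepth (R : Type*) [CommRing R] [IsLocalRing R]
    (M : Type*) [AddCommGroup M] [Module R M] : ℕ∞ :=
  if IsLocalRing.maximalIdeal R • (⊤ : Submodule R M) = ⊤ then ⊤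
  else ⨆ (rs : List R) (_ : RingTheory.Sequence.IsRegular M rs ∧
    ∀ r ∈ rs, r ∈ IsLocalRing.maximalIdeal R), (rs.length : ℕ∞)

/-!
Let `a, b, c` be the three minors and `d = (b ^ 2 - a c) / x`, which is again an element of the
ring. The filtration `J₀ = R`, `J₁ = I`, `Jₙ₊₂ = I Jₙ₊₁ + d Jₙ` lies between the powers and the
symbolic powers of `I`. From `I ^ 2 ⊆ a I + (d)` one obtains
`Jₙ₊₁ = a Jₙ + d ^ ⌊(n + 1) / 2⌋ I ^ ((n + 1) mod 2)`, hence exact sequences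
`0 → R / Jₙ → R / Jₙ₊₁ → R / (a, d ^ i I ^ ε) → 0` whose first map is multiplication by `a`, and
they show by induction that `x` is regular on every `R / Jₙ`. On the other hand `𝔪 d ⊆ I ^ 2` gives
`Jₙ 𝔪 ^ ⌊n / 2⌋ ⊆ I ^ n`, and `I⁽ⁿ⁾ = I ^ n : x ^ ∞` because the maximal ideal is the only prime
over `I + (x)`. Hence `I ^ n : x ^ ∞ ⊆ Jₙ ⊆ I ^ n : 𝔪 ^ ⌊n / 2⌋ ⊆ I ^ n : x ^ ∞`.
-/

open IsLocalRing RingTheory.Sequence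
open scoped Pointwise

section RegularLocalRing

variable {R : Type*} [CommRing R]

theorem spanFinrank_map_maximalIdeal_lt [IsLocalRing R] [IsNoetherianRing R] {x : R}
    (hx : x ∈ maximalIdeal R) (hx2 : x ∉ maximalIdeal R ^ 2) :
    ((maximalIdeal R).map (Ideal.Quotient.mk (Ideal.span {x}))).spanFinrank <
      (maximalIdeal R).spanFinrank := by
  classical
  obtain ⟨s, hcard, hs⟩ := Submodule.FG.exists_span_finset_card_eq_spanFinrank
    (maximalIdeal R).fg_of_isNoetherianRing
  have hmem {t : R} (ht : t ∈ s) : t ∈ maximalIdeal R := hs ▸ Submodule.subset_span ht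
  obtain ⟨f, -, hf⟩ := Submodule.mem_span_finset.mp (hs ▸ hx)
  obtain ⟨t, hts, ht⟩ : ∃ t ∈ s, f t ∉ maximalIdeal R := by
    by_contra! h
    exact hx2 (hf ▸ pow_two (maximalIdeal R) ▸
      sum_mem fun t ht ↦ Ideal.mul_mem_mul (h t ht) (hmem ht))
  let π := Ideal.Quotient.mk (Ideal.span {x})
  have hπt : π t ∈ Ideal.span (π '' (s.erase t)) := by
    have hsum : π (f t) * π t + ∑ u ∈ s.erase t, π (f u) * π u = 0 := by
      rw [Finset.add_sum_erase s (fun u ↦ π (f u) * π u) hts]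
      simpa only [map_sum, smul_eq_mul, map_mul] using
        (congrArg π hf).trans (Ideal.Quotient.mk_singleton_self x)
    refine (Ideal.unit_mul_mem_iff_mem _ ((notMem_maximalIdeal.mp ht).map π)).mp ?_
    rw [eq_neg_of_add_eq_zero_left hsum]
    exact neg_mem (sum_mem fun u hu ↦
      Ideal.mul_mem_left _ _ (Ideal.subset_span (Set.mem_image_of_mem π hu)))
  have hspan : (maximalIdeal R).map π = Ideal.span (π '' (s.erase t)) := by
    rw [← hs, Ideal.submodule_span_eq, Ideal.map_span]
    nth_rw 1 [← Finset.insert_erase hts]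
    rw [Finset.coe_insert, Set.image_insert_eq]
    exact Submodule.span_insert_eq_span hπt
  calc ((maximalIdeal R).map π).spanFinrank
      ≤ (π '' (s.erase t)).ncard :=
        hspan ▸ Submodule.spanFinrank_span_le_ncard_of_finite (Set.toFinite _)
    _ ≤ (s.erase t).card := (Set.ncard_image_le (Set.toFinite _)).trans_eq (Set.ncard_coe_finset _)
    _ < (maximalIdeal R).spanFinrank := hcard ▸ Finset.card_erase_lt_of_mem hts

theorem isLocalRing_quotient_span_singleton [IsLocalRing R] {x : R} (hx : x ∈ maximalIdeal R) :
    IsLocalRing (R ⧸ Ideal.span {x}) :=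
  have : Nontrivial (R ⧸ Ideal.span {x}) := Ideal.Quotient.nontrivial_iff.mpr
    (Ideal.span_singleton_eq_top.not.mpr hx)
  .of_surjective' _ Ideal.Quotient.mk_surjective

theorem ringKrullDim_le_ringKrullDim_quotient_span_singleton_add_one [IsLocalRing R]
    [IsNoetherianRing R] {x : R} (hx : x ∈ maximalIdeal R) :
    ringKrullDim R ≤ ringKrullDim (R ⧸ Ideal.span {x}) + 1 := by
  rw [← maximalIdeal_height_eq_ringKrullDim]
  exact Ideal.height_le_ringKrullDim_quotient_add_one hx

theorem isRegularLocalRing_quotient_span_singleton [IsRegularLocalRing R] {x : R}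
    (hx : x ∈ maximalIdeal R) (hx2 : x ∉ maximalIdeal R ^ 2) :
    IsRegularLocalRing (R ⧸ Ideal.span {x}) := by
  have := isLocalRing_quotient_span_singleton hx
  refine .of_spanFinrank_maximalIdeal_le _ ?_
  have hlt := spanFinrank_map_maximalIdeal_lt hx hx2
  rw [map_maximalIdeal_of_surjective _ Ideal.Quotient.mk_surjective] at hlt
  have hdim := ringKrullDim_le_ringKrullDim_quotient_span_singleton_add_one hx
  rw [← IsRegularLocalRing.spanFinrank_maximalIdeal (R := R)] at hdim
  have hsucc : ((maximalIdeal (R ⧸ Ideal.span {x})).spanFinrank : WithBot ℕ∞) + 1 ≤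
      ringKrullDim (R ⧸ Ideal.span {x}) + 1 := le_trans (mod_cast hlt) hdim
  exact ENat.WithBot.add_le_add_one_right_iff.mp hsucc

theorem isDomain_of_isPrime_span_singleton [IsLocalRing R] [IsNoetherianRing R] {x : R}
    (hx : x ∈ maximalIdeal R) [(Ideal.span {x}).IsPrime]
    (hmin : ∀ P ∈ minimalPrimes R, x ∉ P) : IsDomain R := by
  obtain ⟨P, hP, hPx⟩ := Ideal.exists_minimalPrimes_le (bot_le (a := Ideal.span {x}))
  have : P.IsPrime := hP.1.1
  suffices P = ⊥ from (IsDomain.of_bot_isPrime (A := R) (hbp := this ▸ hP.1.1))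
  have hle : P ≤ maximalIdeal R • P := fun p hp ↦ by
    obtain ⟨r, rfl⟩ := Ideal.mem_span_singleton.mp (hPx hp)
    exact Ideal.mul_mem_mul hx ((this.mem_or_mem hp).resolve_left (hmin P hP))
  exact Submodule.eq_bot_of_le_smul_of_le_jacobson_bot _ P P.fg_of_isNoetherianRing hle
    (maximalIdeal_le_jacobson _)

theorem exists_mem_maximalIdeal_notMem_sq_forall_minimalPrimes [IsLocalRing R]
    [IsNoetherianRing R] (hdim : 0 < ringKrullDim R) :
    ∃ x ∈ maximalIdeal R, x ∉ maximalIdeal R ^ 2 ∧ ∀ P ∈ minimalPrimes R, x ∉ P := by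
  have hm : maximalIdeal R ∉ minimalPrimes R := by
    rw [← Ideal.height_eq_zero_iff, ← WithBot.coe_inj, maximalIdeal_height_eq_ringKrullDim]
    exact hdim.ne'
  by_contra! h
  have hcover : (maximalIdeal R : Set R) ⊆
      ⋃ J ∈ insert (maximalIdeal R ^ 2) (minimalPrimes R), (J : Set R) := by
    intro x hx
    by_cases hx2 : x ∈ maximalIdeal R ^ 2
    · exact Set.mem_biUnion (Set.mem_insert _ _) hx2
    · obtain ⟨P, hP, hxP⟩ := h x hx hx2
      exact Set.mem_biUnion (Set.mem_insert_of_mem _ hP) hxP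
  obtain ⟨J, rfl | hJ, hle⟩ := (Ideal.subset_union_prime_finite
    ((minimalPrimes.finite_of_isNoetherianRing R).insert _) (maximalIdeal R ^ 2) ⊥
    fun J hJ hne _ ↦ (hJ.resolve_left hne).1.1).mp hcover
  · exact (maximalIdeal_sq_lt_of_ringKrullDim_ne_zero hdim.ne').not_ge hle
  · have : J.IsPrime := hJ.1.1
    exact hm (((maximalIdeal.isMaximal R).eq_of_le this.ne_top hle) ▸ hJ)

theorem isDomain_of_isRegularLocalRing [IsRegularLocalRing R] : IsDomain R := by
  induction h : (maximalIdeal R).spanFinrank using Nat.strong_induction_on generalizing R with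
  | _ n ih =>
  have hn := IsRegularLocalRing.spanFinrank_maximalIdeal (R := R)
  rcases n.eq_zero_or_pos with rfl | hpos
  · have hbot := (Submodule.spanFinrank_eq_zero_iff_eq_bot
      (maximalIdeal R).fg_of_isNoetherianRing).mp h
    exact IsDomain.of_bot_isPrime (A := R) (hbp := hbot ▸ (maximalIdeal.isMaximal R).isPrime)
  · obtain ⟨x, hx, hx2, hmin⟩ := exists_mem_maximalIdeal_notMem_sq_forall_minimalPrimes
      (R := R) (by rw [← hn, h]; exact_mod_cast hpos)
    have := isRegularLocalRing_quotient_span_singleton hx hx2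
    have hlt := spanFinrank_map_maximalIdeal_lt hx hx2
    rw [map_maximalIdeal_of_surjective _ Ideal.Quotient.mk_surjective, h] at hlt
    have := ih _ hlt rfl
    have := (Ideal.Quotient.isDomain_iff_prime (Ideal.span {x})).mp this
    exact isDomain_of_isPrime_span_singleton hx hmin

theorem spanFinrank_ofList_le_length {l : List R} :
    (Ideal.ofList l).spanFinrank ≤ l.length := by
  classical
  have hfin : {r | r ∈ l}.Finite := l.finite_toSet
  refine (Submodule.spanFinrank_span_le_ncard_of_finite hfin).trans ?_
  rw [← List.coe_toFinset, Set.ncard_coe_finset]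
  exact l.toFinset_card_le

theorem isRegularLocalRing_of_ofList_eq_maximalIdeal [IsLocalRing R] [IsNoetherianRing R]
    {l : List R} (hl : Ideal.ofList l = maximalIdeal R)
    (hlen : (l.length : WithBot ℕ∞) ≤ ringKrullDim R) : IsRegularLocalRing R :=
  .of_spanFinrank_maximalIdeal_le _
    ((Nat.cast_le.mpr (hl ▸ spanFinrank_ofList_le_length)).trans hlen)

theorem isWeaklyRegular_cons_iff_quotient_span_singleton {a : R} {l : List R} :
    IsWeaklyRegular R (a :: l) ↔ IsSMulRegular R a ∧ IsWeaklyRegular (R ⧸ Ideal.span {a})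
      (l.map (Ideal.Quotient.mk (Ideal.span {a}))) := by
  have htop : (a • ⊤ : Submodule R R) = Ideal.span {a} := by
    rw [← Submodule.ideal_span_singleton_smul, smul_eq_mul, Ideal.mul_top]
  rw [isWeaklyRegular_cons_iff, (Submodule.quotEquivOfEq _ _ htop).isWeaklyRegular_congr]
  exact and_congr_right fun _ ↦
    (isWeaklyRegular_map_algebraMap_iff (R ⧸ Ideal.span {a}) (R ⧸ Ideal.span {a}) l).symm

theorem isSMulRegular_of_ofList_cons_eq_maximalIdeal [IsLocalRing R] [IsNoetherianRing R] {a : R}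
    {l : List R} (hl : Ideal.ofList (a :: l) = maximalIdeal R)
    (hlen : ((a :: l).length : WithBot ℕ∞) ≤ ringKrullDim R) : IsSMulRegular R a := by
  have := isRegularLocalRing_of_ofList_eq_maximalIdeal hl hlen
  have := isDomain_of_isRegularLocalRing (R := R)
  refine .of_ne_zero ?_
  rintro rfl
  have hle : (maximalIdeal R).spanFinrank ≤ l.length := by
    rw [← hl, Ideal.ofList_cons, Ideal.span_singleton_zero, bot_sup_eq]
    exact spanFinrank_ofList_le_length
  have hlt : (l.length : WithBot ℕ∞) < (l.length + 1 : ℕ) := by exact_mod_cast l.length.lt_succ_self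
  exact hlt.not_ge ((hlen.trans (ringKrullDim_le_spanFinrank_maximalIdeal R)).trans
    (Nat.cast_le.mpr hle))

theorem isWeaklyRegular_of_ofList_eq_maximalIdeal [IsLocalRing R] [IsNoetherianRing R] {l : List R}
    (hl : Ideal.ofList l = maximalIdeal R) (hlen : (l.length : WithBot ℕ∞) ≤ ringKrullDim R) :
    IsWeaklyRegular R l := by
  induction hn : l.length generalizing R l with
  | zero => exact List.length_eq_zero_iff.mp hn ▸ .nil R R
  | succ n ih =>
    obtain ⟨a, t, rfl⟩ := List.exists_cons_of_length_eq_add_one hn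
    have ha : a ∈ maximalIdeal R := hl ▸ Ideal.subset_span List.mem_cons_self
    have := isLocalRing_quotient_span_singleton ha
    refine isWeaklyRegular_cons_iff_quotient_span_singleton.mpr
      ⟨isSMulRegular_of_ofList_cons_eq_maximalIdeal hl hlen, ih ?_ ?_ ?_⟩
    · rw [← map_maximalIdeal_of_surjective _ Ideal.Quotient.mk_surjective, ← hl, Ideal.ofList_cons,
        Ideal.map_sup, Ideal.map_quotient_self, bot_sup_eq, Ideal.map_ofList]
    · have h := hlen.trans (ringKrullDim_le_ringKrullDim_quotient_span_singleton_add_one ha)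
      rw [List.length_cons, Nat.cast_succ] at h
      simpa only [List.length_map] using ENat.WithBot.add_le_add_one_right_iff.mp h
    · simpa only [List.length_map, List.length_cons, Nat.add_right_cancel_iff] using hn

end RegularLocalRing

section SymbolicPower

variable {R : Type*} [CommRing R] {I K : Ideal R} {n : ℕ} {s x : R}

theorem mem_symbolicPower_iff :
    s ∈ symbolicPower I n ↔ ∀ p ∈ I.minimalPrimes, ∃ u ∉ p, u * s ∈ I ^ n := by
  simp only [symbolicPower, Ideal.mem_iInf, Ideal.mem_comap]
  refine ⟨fun h p hp ↦ ?_, fun h p hp ↦ ?_⟩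
  · have := hp.1.1
    obtain ⟨u, hu, hus⟩ := (IsLocalization.algebraMap_mem_map_algebraMap_iff p.primeCompl
      (Localization.AtPrime p) (I ^ n) s).mp (h ⟨p, hp.1.1⟩ hp)
    exact ⟨u, hu, hus⟩
  · obtain ⟨u, hu, hus⟩ := h p.asIdeal hp
    exact (IsLocalization.algebraMap_mem_map_algebraMap_iff p.asIdeal.primeCompl
      (Localization.AtPrime p.asIdeal) (I ^ n) s).mpr ⟨u, hu, hus⟩

theorem pow_mul_mem_iff_of_isSMulRegular (hx : IsSMulRegular (R ⧸ K) x) {k : ℕ} :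
    x ^ k * s ∈ K ↔ s ∈ K :=
  ⟨mem_of_isSMulRegular_quotient_of_smul_mem (hx.pow k), K.mul_mem_left _⟩

theorem mem_minimalPrimes_of_notMem [IsLocalRing R] [IsNoetherianRing R]
    (hrad : (I ⊔ Ideal.span {x}).radical = maximalIdeal R) {P : Ideal R} [P.IsPrime]
    (hIP : I ≤ P) (hxP : x ∉ P) : P ∈ I.minimalPrimes := by
  have hspan : Ideal.span (insert x (I : Set R)) = I ⊔ Ideal.span {x} := by
    rw [Ideal.span_insert, Ideal.span_eq, sup_comm]
  have hxm : x ∈ maximalIdeal R :=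
    hrad ▸ Ideal.le_radical (Ideal.mem_sup_right (Ideal.mem_span_singleton_self x))
  have hlt : P < maximalIdeal R :=
    (le_maximalIdeal_of_isPrime P).lt_of_ne fun h ↦ hxP (h ▸ hxm)
  have hmin : maximalIdeal R ∈ (Ideal.span (insert x (I : Set R))).minimalPrimes := by
    rw [hspan, ← Ideal.radical_minimalPrimes, hrad, Ideal.minimalPrimes_eq_subsingleton_self]
    rfl
  have hIrad : (I : Set R) ⊆ (Ideal.span (insert x (I : Set R))).radical :=
    fun r hr ↦ Ideal.le_radical (Ideal.subset_span (Set.mem_insert_of_mem _ hr))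
  simpa only [Ideal.span_eq] using
    Ideal.mem_minimalPrimes_span_of_mem_minimalPrimes_span_insert hlt x _ hmin _ hIP hIrad

theorem mem_symbolicPower_iff_exists_pow_mul_mem [IsLocalRing R] [IsNoetherianRing R]
    (hrad : (I ⊔ Ideal.span {x}).radical = maximalIdeal R) (hx : IsSMulRegular (R ⧸ I) x) :
    s ∈ symbolicPower I n ↔ ∃ k, x ^ k * s ∈ I ^ n := by
  rw [mem_symbolicPower_iff]
  refine ⟨fun h ↦ ?_, fun ⟨k, hk⟩ p hp ↦ ⟨x ^ k, ?_, hk⟩⟩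
  · suffices hmem : x ∈ ((I ^ n).colon {s}).radical by
      obtain ⟨k, hk⟩ := hmem
      exact ⟨k, Submodule.mem_colon_singleton.mp hk⟩
    rw [Ideal.radical_eq_sInf, Ideal.mem_sInf]
    rintro P ⟨hle, hP⟩
    have hIP : I ≤ P := hP.le_of_pow_le fun r hr ↦
      hle (Submodule.mem_colon_singleton.mpr (Ideal.mul_mem_right s _ hr))
    by_contra hxP
    obtain ⟨u, huP, hus⟩ := h P (mem_minimalPrimes_of_notMem hrad hIP hxP)
    exact huP (hle (Submodule.mem_colon_singleton.mpr hus))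
  · have hp' : p ∈ (Module.annihilator R (R ⧸ I)).minimalPrimes := by
      rwa [Ideal.annihilator_quotient]
    exact mt (hp.1.1.mem_of_pow_mem k) (hx.notMem_of_mem_minimalPrimes hp')

theorem symbolicPower_eq_of_isSMulRegular [IsLocalRing R] [IsNoetherianRing R]
    (hrad : (I ⊔ Ideal.span {x}).radical = maximalIdeal R) (hxI : IsSMulRegular (R ⧸ I) x)
    (hxK : IsSMulRegular (R ⧸ K) x) (hle : I ^ n ≤ K) {k : ℕ} (hk : ∀ s ∈ K, x ^ k * s ∈ I ^ n) :
    symbolicPower I n = K := by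
  ext s
  rw [mem_symbolicPower_iff_exists_pow_mul_mem hrad hxI]
  exact ⟨fun ⟨_, hs⟩ ↦ (pow_mul_mem_iff_of_isSMulRegular hxK).mp (hle hs), fun hs ↦ ⟨k, hk s hs⟩⟩

theorem localDepth_pos_of_isSMulRegular [IsLocalRing R] {M : Type*} [AddCommGroup M] [Module R M]
    (hx : x ∈ maximalIdeal R) (hreg : IsSMulRegular M x) : 0 < localDepth R M := by
  unfold localDepth
  split_ifs with h
  · exact ENat.top_pos
  · have hne : (⊤ : Submodule R M) ≠ Ideal.ofList [x] • ⊤ := fun htop ↦ h <| top_le_iff.mp <|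
      htop.le.trans <| Submodule.smul_mono_left <| by
        rwa [Ideal.ofList_singleton, Ideal.span_singleton_le_iff_mem]
    calc (0 : ℕ∞) < ([x].length : ℕ∞) := by simp
      _ ≤ _ := le_iSup₂_of_le [x] ⟨⟨(isWeaklyRegular_singleton_iff M x).mpr hreg, hne⟩,
        by simpa only [List.mem_singleton, forall_eq] using hx⟩ le_rfl

end SymbolicPower

theorem isSMulRegular_quotient_sup_span_singleton_mul {R : Type*} [CommRing R] {A T : Ideal R}
    {f x : R} (hf : ∀ r, f * r ∈ A → r ∈ T) (hT : IsSMulRegular (R ⧸ T) x)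
    (hA : IsSMulRegular (R ⧸ A ⊔ Ideal.span {f}) x) :
    IsSMulRegular (R ⧸ A ⊔ Ideal.span {f} * T) x := by
  rw [isSMulRegular_quotient_iff_mem_of_smul_mem] at hT hA ⊢
  simp only [smul_eq_mul] at hT hA ⊢
  intro w hw
  have hwA : w ∈ A ⊔ Ideal.span {f} := hA w (sup_le_sup_left Ideal.mul_le_left A hw)
  obtain ⟨α, hα, _, hft, hαft⟩ := Submodule.mem_sup.mp hw
  obtain ⟨t, ht, rfl⟩ := Ideal.mem_span_singleton_mul.mp hft
  obtain ⟨β, hβ, _, hfv, rfl⟩ := Submodule.mem_sup.mp hwA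
  obtain ⟨v, rfl⟩ := Ideal.mem_span_singleton.mp hfv
  have hsub : x * v - t ∈ T := hf _ <| by
    have heq : f * (x * v - t) = α - x * β := by linear_combination -hαft
    exact heq ▸ sub_mem hα (A.mul_mem_left x hβ)
  have hv : v ∈ T := hT v (sub_add_cancel (x * v) t ▸ add_mem hsub ht)
  exact add_mem (Ideal.mem_sup_left hβ)
    (Ideal.mem_sup_right (Ideal.mul_mem_mul (Ideal.mem_span_singleton_self f) hv))

theorem isSMulRegular_quotient_top {R : Type*} [CommRing R] {x : R} :
    IsSMulRegular (R ⧸ (⊤ : Ideal R)) x :=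
  (isSMulRegular_quotient_iff_mem_of_smul_mem _ _).mpr fun _ _ ↦ Submodule.mem_top

/-- The graded filtration generated by `I` in degree one and `d` in degree two, so that the
`n`-th piece is the sum of the ideals `d ^ j * I ^ (n - 2 * j)`. It will be shown to consist of
the symbolic powers of `I`, whose symbolic Rees algebra is thus generated in degree two. -/
def degreeTwoFiltration {R : Type*} [CommRing R] (I : Ideal R) (d : R) : ℕ → Ideal R
  | 0 => ⊤
  | 1 => I
  | n + 2 => I * degreeTwoFiltration I d (n + 1) ⊔ Ideal.span {d} * degreeTwoFiltration I d n

/-- The ideal `(d) ^ ⌊n / 2⌋ * I ^ (n mod 2)`, which is what remains of the `n`-th piece of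
`degreeTwoFiltration I d` modulo an element `a` of `I` with `I ^ 2 ⊆ a I + (d)`. -/
def degreeTwoResidue {R : Type*} [CommRing R] (I : Ideal R) (d : R) (n : ℕ) : Ideal R :=
  Ideal.span {d} ^ (n / 2) * I ^ (n % 2)

section Filtration

variable {R : Type*} [CommRing R] {I : Ideal R} {a d x : R}

theorem degreeTwoFiltration_add_two (n : ℕ) :
    degreeTwoFiltration I d (n + 2) = I * degreeTwoFiltration I d (n + 1) ⊔
      Ideal.span {d} * degreeTwoFiltration I d n := by
  rw [degreeTwoFiltration]

theorem degreeTwoResidue_zero : degreeTwoResidue I d 0 = ⊤ := by simp [degreeTwoResidue]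

theorem degreeTwoResidue_one : degreeTwoResidue I d 1 = I := by simp [degreeTwoResidue]

theorem degreeTwoResidue_add_two (n : ℕ) :
    degreeTwoResidue I d (n + 2) = Ideal.span {d} * degreeTwoResidue I d n := by
  rw [degreeTwoResidue, degreeTwoResidue, Nat.add_div_right _ two_pos, Nat.add_mod_right, pow_succ',
    mul_assoc]

theorem mul_degreeTwoFiltration_le (n : ℕ) :
    I * degreeTwoFiltration I d n ≤ degreeTwoFiltration I d (n + 1) := by
  cases n with
  | zero => exact Ideal.mul_le_left (I := I) (J := ⊤)
  | succ n => rw [degreeTwoFiltration_add_two]; exact le_sup_left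

theorem span_singleton_mul_degreeTwoFiltration_le (n : ℕ) :
    Ideal.span {d} * degreeTwoFiltration I d n ≤ degreeTwoFiltration I d (n + 2) := by
  rw [degreeTwoFiltration_add_two]; exact le_sup_right

theorem pow_le_degreeTwoFiltration (n : ℕ) : I ^ n ≤ degreeTwoFiltration I d n := by
  induction n with
  | zero => exact le_top
  | succ n ih =>
    rw [pow_succ']
    exact (Ideal.mul_mono_right ih).trans (mul_degreeTwoFiltration_le n)

theorem degreeTwoFiltration_mul_pow_le {m : Ideal R} (hm : Ideal.span {d} * m ≤ I ^ 2) (n : ℕ) :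
    degreeTwoFiltration I d n * m ^ (n / 2) ≤ I ^ n := by
  induction n using Nat.twoStepInduction with
  | zero => simp
  | one => simp [degreeTwoFiltration]
  | more n ih0 ih1 =>
    rw [degreeTwoFiltration_add_two, Nat.add_div_right _ two_pos, Ideal.sup_mul]
    refine sup_le ?_ ?_
    · have hle : m ^ (n / 2 + 1) ≤ m ^ ((n + 1) / 2) := Ideal.pow_le_pow_right (by omega)
      calc I * degreeTwoFiltration I d (n + 1) * m ^ (n / 2 + 1)
          ≤ I * (degreeTwoFiltration I d (n + 1) * m ^ ((n + 1) / 2)) := by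
            rw [mul_assoc]; exact Ideal.mul_mono_right (Ideal.mul_mono_right hle)
        _ ≤ I * I ^ (n + 1) := Ideal.mul_mono_right ih1
        _ = I ^ (n + 2) := by ring
    · calc Ideal.span {d} * degreeTwoFiltration I d n * m ^ (n / 2 + 1)
          = (Ideal.span {d} * m) * (degreeTwoFiltration I d n * m ^ (n / 2)) := by ring
        _ ≤ I ^ 2 * I ^ n := Ideal.mul_mono hm ih0
        _ = I ^ (n + 2) := by ring

theorem degreeTwoResidue_le_degreeTwoFiltration (n : ℕ) :
    degreeTwoResidue I d n ≤ degreeTwoFiltration I d n := by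
  induction n using Nat.twoStepInduction with
  | zero => exact le_top
  | one => exact degreeTwoResidue_one.le
  | more n ih _ =>
    rw [degreeTwoResidue_add_two]
    exact (Ideal.mul_mono_right ih).trans (span_singleton_mul_degreeTwoFiltration_le n)

theorem span_singleton_mul_sup_degreeTwoResidue_le (n : ℕ) :
    Ideal.span {d} * (Ideal.span {a} * degreeTwoFiltration I d n ⊔ degreeTwoResidue I d (n + 1)) ≤
      Ideal.span {a} * degreeTwoFiltration I d (n + 2) ⊔ degreeTwoResidue I d (n + 3) := by
  rw [Ideal.mul_sup, mul_left_comm, degreeTwoResidue_add_two]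
  exact sup_le_sup_right (Ideal.mul_mono_right (span_singleton_mul_degreeTwoFiltration_le n)) _

theorem mul_degreeTwoResidue_le (hI : I ^ 2 ≤ Ideal.span {a} * I ⊔ Ideal.span {d}) (n : ℕ) :
    I * degreeTwoResidue I d n ≤
      Ideal.span {a} * degreeTwoFiltration I d n ⊔ degreeTwoResidue I d (n + 1) := by
  induction n using Nat.twoStepInduction with
  | zero =>
    rw [degreeTwoResidue_zero, Ideal.mul_top, degreeTwoResidue_one]
    exact le_sup_right
  | one =>
    rw [degreeTwoResidue_one, degreeTwoResidue_add_two, degreeTwoResidue_zero, Ideal.mul_top,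
      ← pow_two]
    exact hI
  | more n ih _ =>
    rw [degreeTwoResidue_add_two, mul_left_comm]
    exact (Ideal.mul_mono_right ih).trans (span_singleton_mul_sup_degreeTwoResidue_le n)

theorem degreeTwoFiltration_succ_eq (ha : a ∈ I)
    (hI : I ^ 2 ≤ Ideal.span {a} * I ⊔ Ideal.span {d}) (n : ℕ) :
    degreeTwoFiltration I d (n + 1) =
      Ideal.span {a} * degreeTwoFiltration I d n ⊔ degreeTwoResidue I d (n + 1) := by
  refine le_antisymm ?_ (sup_le ((Ideal.mul_mono_left ((Ideal.span_singleton_le_iff_mem I).mpr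
    ha)).trans (mul_degreeTwoFiltration_le n)) (degreeTwoResidue_le_degreeTwoFiltration _))
  have step (n : ℕ) (h : degreeTwoFiltration I d (n + 1) ≤
      Ideal.span {a} * degreeTwoFiltration I d n ⊔ degreeTwoResidue I d (n + 1)) :
      I * degreeTwoFiltration I d (n + 1) ≤
        Ideal.span {a} * degreeTwoFiltration I d (n + 1) ⊔ degreeTwoResidue I d (n + 2) := by
    refine (Ideal.mul_mono_right h).trans ?_
    rw [Ideal.mul_sup, mul_left_comm]
    exact sup_le (le_sup_of_le_left (Ideal.mul_mono_right (mul_degreeTwoFiltration_le n)))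
      (mul_degreeTwoResidue_le hI (n + 1))
  induction n using Nat.twoStepInduction with
  | zero => exact le_sup_of_le_right degreeTwoResidue_one.ge
  | one =>
    refine sup_le (step 0 (le_sup_of_le_right degreeTwoResidue_one.ge)) (le_sup_of_le_right ?_)
    rw [degreeTwoResidue_add_two, degreeTwoResidue_zero]
    rfl
  | more n ih0 ih1 =>
    exact sup_le (step (n + 1) ih1)
      ((Ideal.mul_mono_right ih0).trans (span_singleton_mul_sup_degreeTwoResidue_le n))

theorem isSMulRegular_quotient_sup_degreeTwoResidue (ha : a ∈ I)
    (hd : IsSMulRegular (R ⧸ Ideal.span {a}) d)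
    (hx : IsSMulRegular (R ⧸ Ideal.span {a} ⊔ Ideal.span {d}) x)
    (hxI : IsSMulRegular (R ⧸ I) x) (n : ℕ) :
    IsSMulRegular (R ⧸ Ideal.span {a} ⊔ degreeTwoResidue I d n) x := by
  induction n using Nat.twoStepInduction with
  | zero => rw [degreeTwoResidue_zero, sup_top_eq]; exact isSMulRegular_quotient_top
  | one =>
    rwa [degreeTwoResidue_one, sup_eq_right.mpr ((Ideal.span_singleton_le_iff_mem I).mpr ha)]
  | more n ih _ =>
    have heq : Ideal.span {a} ⊔ degreeTwoResidue I d (n + 2) =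
        Ideal.span {a} ⊔ Ideal.span {d} * (Ideal.span {a} ⊔ degreeTwoResidue I d n) := by
      rw [degreeTwoResidue_add_two, Ideal.mul_sup, ← sup_assoc,
        sup_of_le_left (Ideal.mul_le_right (I := Ideal.span {d}) (J := Ideal.span {a}))]
    rw [heq]
    exact isSMulRegular_quotient_sup_span_singleton_mul (fun r hr ↦ Ideal.mem_sup_left
      (mem_of_isSMulRegular_quotient_of_smul_mem hd hr)) ih hx

theorem mem_degreeTwoFiltration_of_mul_mem (hdI : d ∈ I) (ha : IsSMulRegular R a)
    (hd : IsSMulRegular (R ⧸ Ideal.span {a}) d) {n : ℕ} {r : R}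
    (hr : a * r ∈ degreeTwoResidue I d (n + 1)) : r ∈ degreeTwoFiltration I d n := by
  have exists_eq_mul {n : ℕ} {r : R} (hr : a * r ∈ degreeTwoResidue I d (n + 2)) :
      ∃ s, r = d * s ∧ a * s ∈ degreeTwoResidue I d n := by
    rw [degreeTwoResidue_add_two, Ideal.mem_span_singleton_mul] at hr
    obtain ⟨g, hg, hgr⟩ := hr
    have hga : g ∈ Ideal.span {a} := mem_of_isSMulRegular_quotient_of_smul_mem hd
      (Ideal.mem_span_singleton.mpr ⟨r, hgr⟩)
    obtain ⟨s, rfl⟩ := Ideal.mem_span_singleton.mp hga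
    exact ⟨s, ha (by linear_combination (exp := 1) -hgr), hg⟩
  induction n using Nat.twoStepInduction generalizing r with
  | zero => exact Submodule.mem_top
  | one =>
    obtain ⟨s, rfl, -⟩ := exists_eq_mul hr
    exact I.mul_mem_right s hdI
  | more n ih _ =>
    obtain ⟨s, rfl, hs⟩ := exists_eq_mul hr
    exact span_singleton_mul_degreeTwoFiltration_le n
      (Ideal.mul_mem_mul (Ideal.mem_span_singleton_self d) (ih hs))

theorem isSMulRegular_quotient_degreeTwoFiltration (haI : a ∈ I) (hdI : d ∈ I)
    (hI : I ^ 2 ≤ Ideal.span {a} * I ⊔ Ideal.span {d}) (ha : IsSMulRegular R a)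
    (hd : IsSMulRegular (R ⧸ Ideal.span {a}) d)
    (hx : IsSMulRegular (R ⧸ Ideal.span {a} ⊔ Ideal.span {d}) x)
    (hxI : IsSMulRegular (R ⧸ I) x) (n : ℕ) :
    IsSMulRegular (R ⧸ degreeTwoFiltration I d n) x := by
  induction n with
  | zero => exact isSMulRegular_quotient_top
  | succ n ih =>
    have hA := isSMulRegular_quotient_sup_degreeTwoResidue haI hd hx hxI (n + 1)
    rw [sup_comm] at hA
    rw [degreeTwoFiltration_succ_eq haI hI, sup_comm]
    exact isSMulRegular_quotient_sup_span_singleton_mul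
      (fun r hr ↦ mem_degreeTwoFiltration_of_mul_mem hdI ha hd hr) ih hA

theorem degreeTwoFiltration_eq_colon {m : Ideal R} (hm : Ideal.span {d} * m ≤ I ^ 2) {n : ℕ}
    (hxm : x ∈ m) (hx : IsSMulRegular (R ⧸ degreeTwoFiltration I d n) x) :
    degreeTwoFiltration I d n = (I ^ n).colon ((m ^ (n / 2) : Ideal R) : Set R) := by
  ext s
  refine ⟨fun hs ↦ Submodule.mem_colon.mpr fun t ht ↦
    degreeTwoFiltration_mul_pow_le hm n (Ideal.mul_mem_mul hs ht), fun hs ↦ ?_⟩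
  have hxs := Submodule.mem_colon.mp hs (x ^ (n / 2)) (Ideal.pow_mem_pow hxm _)
  rw [smul_eq_mul, mul_comm] at hxs
  exact mem_of_isSMulRegular_quotient_of_smul_mem (hx.pow _) (pow_le_degreeTwoFiltration n hxs)

end Filtration

section RegularSequence

variable {R : Type*} [CommRing R] {r s t : R} {k : ℕ}

theorem isSMulRegular_quotient_of_pow_sub_mul_mem {J : Ideal R} (hr : IsSMulRegular (R ⧸ J) r)
    (h : r ^ k - t * s ∈ J) : IsSMulRegular (R ⧸ J) s := by
  refine (isSMulRegular_quotient_iff_mem_of_smul_mem _ _).mpr fun w hw ↦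
    mem_of_isSMulRegular_quotient_of_smul_mem (hr.pow k) ?_
  have heq : r ^ k • w = w * (r ^ k - t * s) + t * (s • w) := by
    simp only [smul_eq_mul]; ring
  exact heq ▸ add_mem (J.mul_mem_left w h) (J.mul_mem_left t hw)

theorem isWeaklyRegular_concat_iff {l : List R} :
    IsWeaklyRegular R (l ++ [r]) ↔ IsWeaklyRegular R l ∧ IsSMulRegular (R ⧸ Ideal.ofList l) r := by
  have htop : (Ideal.ofList l • ⊤ : Submodule R R) = Ideal.ofList l := by
    rw [smul_eq_mul, Ideal.mul_top]
  rw [isWeaklyRegular_append_iff, isWeaklyRegular_singleton_iff,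
    (Submodule.quotEquivOfEq _ _ htop).isSMulRegular_congr]

theorem isWeaklyRegular_concat_of_pow_sub_mul_mem {l : List R} (hr : IsWeaklyRegular R (l ++ [r]))
    (h : r ^ k - t * s ∈ Ideal.ofList l) : IsWeaklyRegular R (l ++ [s]) := by
  rw [isWeaklyRegular_concat_iff] at hr ⊢
  exact ⟨hr.1, isSMulRegular_quotient_of_pow_sub_mul_mem hr.2 h⟩

theorem isWeaklyRegular_triple_iff : IsWeaklyRegular R [r, s, t] ↔ IsSMulRegular R r ∧
    IsSMulRegular (R ⧸ Ideal.span {r}) s ∧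
      IsSMulRegular (R ⧸ Ideal.span {r} ⊔ Ideal.span {s}) t := by
  rw [show [r, s, t] = [r] ++ [s] ++ [t] from rfl, isWeaklyRegular_concat_iff,
    isWeaklyRegular_concat_iff, isWeaklyRegular_singleton_iff, Ideal.ofList_append,
    Ideal.ofList_singleton, Ideal.ofList_singleton, and_assoc]

end RegularSequence

theorem minorsIdeal_two_of_two_by_three {R : Type*} [CommRing R] (A : Matrix (Fin 2) (Fin 3) R) :
    minorsIdeal 2 A = Ideal.span {A 0 0 * A 1 1 - A 0 1 * A 1 0,
      A 0 0 * A 1 2 - A 0 2 * A 1 0, A 0 1 * A 1 2 - A 0 2 * A 1 1} := by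
  have hmem (i j : Fin 3) (hij : i < j) : A 0 i * A 1 j - A 0 j * A 1 i ∈ minorsIdeal 2 A := by
    refine Ideal.subset_span ⟨RelEmbedding.refl _,
      OrderEmbedding.ofStrictMono ![i, j] (by simpa [Fin.strictMono_iff_lt_succ] using hij), ?_⟩
    simp [Matrix.det_fin_two]
  refine le_antisymm (Ideal.span_le.mpr ?_) (Ideal.span_le.mpr ?_)
  · rintro _ ⟨r, c, rfl⟩
    have hr : r 0 < r 1 := r.strictMono (by decide)
    have hc : c 0 < c 1 := c.strictMono (by decide)
    obtain ⟨hr0, hr1⟩ : r 0 = 0 ∧ r 1 = 1 := by omega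
    obtain ⟨h0, h1⟩ | ⟨h0, h1⟩ | ⟨h0, h1⟩ :
        (c 0 = 0 ∧ c 1 = 1) ∨ (c 0 = 0 ∧ c 1 = 2) ∨ (c 0 = 1 ∧ c 1 = 2) := by omega
    all_goals
      simp only [Matrix.det_fin_two, Matrix.submatrix_apply, hr0, hr1, h0, h1]
      exact Ideal.subset_span (by simp)
  · rintro _ (rfl | rfl | rfl)
    exacts [hmem 0 1 (by decide), hmem 0 2 (by decide), hmem 1 2 (by decide)]

/-- The ideal of `2 × 2` minors of `!![x, y, z; y, z, x * e]`. For `e = x` this is the ideal of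
the space curve `(t ^ 3, t ^ 4, t ^ 5)`. -/
def spaceCurveIdeal {R : Type*} [CommRing R] (x y z e : R) : Ideal R :=
  Ideal.span {x * z - y ^ 2, x ^ 2 * e - y * z, x * y * e - z ^ 2}

/-- The generator in degree two, besides the products of elements of `I`, of the symbolic powers
of `I = spaceCurveIdeal x y z e`. With `a, b, c` the listed generators of `I`, it is
`(b ^ 2 - a * c) / x`. -/
def spaceCurveGenerator {R : Type*} [CommRing R] (x y z e : R) : R :=
  z ^ 3 - 3 * x * y * z * e + y ^ 3 * e + x ^ 3 * e ^ 2

section SpaceCurve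

variable {R : Type*} [CommRing R] (x y z e : R)

theorem minorsIdeal_eq_spaceCurveIdeal :
    minorsIdeal 2 !![x, y, z; y, z, x * e] = spaceCurveIdeal x y z e := by
  rw [minorsIdeal_two_of_two_by_three, spaceCurveIdeal]
  have ha : x * z - y * y = x * z - y ^ 2 := by ring
  have hb : x * (x * e) - z * y = x ^ 2 * e - y * z := by ring
  have hc : y * (x * e) - z * z = x * y * e - z ^ 2 := by ring
  rw [← ha, ← hb, ← hc]
  rfl

theorem fst_mem_spaceCurveIdeal : x * z - y ^ 2 ∈ spaceCurveIdeal x y z e :=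
  Ideal.subset_span (by simp)

theorem snd_mem_spaceCurveIdeal : x ^ 2 * e - y * z ∈ spaceCurveIdeal x y z e :=
  Ideal.subset_span (by simp)

theorem thd_mem_spaceCurveIdeal : x * y * e - z ^ 2 ∈ spaceCurveIdeal x y z e :=
  Ideal.subset_span (by simp)

theorem spaceCurveGenerator_mem : spaceCurveGenerator x y z e ∈ spaceCurveIdeal x y z e := by
  have heq : spaceCurveGenerator x y z e =
      x * e * (x ^ 2 * e - y * z) - y * e * (x * z - y ^ 2) - z * (x * y * e - z ^ 2) := by
    rw [spaceCurveGenerator]; ring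
  rw [heq]
  exact sub_mem (sub_mem (Ideal.mul_mem_left _ _ (snd_mem_spaceCurveIdeal x y z e))
    (Ideal.mul_mem_left _ _ (fst_mem_spaceCurveIdeal x y z e)))
    (Ideal.mul_mem_left _ _ (thd_mem_spaceCurveIdeal x y z e))

theorem spaceCurveIdeal_sq_le : spaceCurveIdeal x y z e ^ 2 ≤
    Ideal.span {x * z - y ^ 2} * spaceCurveIdeal x y z e ⊔
      Ideal.span {spaceCurveGenerator x y z e} := by
  set a := x * z - y ^ 2
  set b := x ^ 2 * e - y * z
  set c := x * y * e - z ^ 2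
  set d := spaceCurveGenerator x y z e
  have hmem {s : R} (t : R) (hs : s ∈ spaceCurveIdeal x y z e) :
      a * s + d * t ∈ Ideal.span {a} * spaceCurveIdeal x y z e ⊔ Ideal.span {d} :=
    Submodule.add_mem_sup (Ideal.mul_mem_mul (Ideal.mem_span_singleton_self a) hs)
      (Ideal.mul_mem_right t _ (Ideal.mem_span_singleton_self d))
  have ha := fst_mem_spaceCurveIdeal x y z e
  have hbb : b * b = a * c + d * x := by grind [spaceCurveGenerator]
  have hbc : b * c = a * (-e * a) + d * y := by grind [spaceCurveGenerator]
  have hcc : c * c = a * (-e * b) + d * z := by grind [spaceCurveGenerator]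
  have hI : spaceCurveIdeal x y z e = Ideal.span {a} ⊔ Ideal.span {b, c} := Ideal.span_insert ..
  calc spaceCurveIdeal x y z e ^ 2
      = Ideal.span {a} * spaceCurveIdeal x y z e ⊔
          (Ideal.span {a} * Ideal.span {b, c} ⊔ Ideal.span {b, c} * Ideal.span {b, c}) := by
        rw [pow_two]
        nth_rw 1 [hI]
        rw [Ideal.sup_mul]
        nth_rw 2 [hI]
        rw [Ideal.mul_sup, mul_comm (Ideal.span {b, c})]
    _ ≤ _ := by
      refine sup_le le_sup_left (sup_le (le_sup_of_le_left (Ideal.mul_mono_right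
        (hI ▸ le_sup_right))) ?_)
      rw [Ideal.span_pair_mul_span_pair, Ideal.span_le]
      rintro _ (rfl | rfl | rfl | rfl)
      · exact hbb ▸ hmem x (thd_mem_spaceCurveIdeal x y z e)
      · exact hbc ▸ hmem y (Ideal.mul_mem_left _ _ ha)
      · exact mul_comm b c ▸ hbc ▸ hmem y (Ideal.mul_mem_left _ _ ha)
      · exact hcc ▸ hmem z (Ideal.mul_mem_left _ _ (snd_mem_spaceCurveIdeal x y z e))

theorem span_spaceCurveGenerator_mul_le :
    Ideal.span {spaceCurveGenerator x y z e} * Ideal.span {x, y, z} ≤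
      spaceCurveIdeal x y z e ^ 2 := by
  set a := x * z - y ^ 2
  set b := x ^ 2 * e - y * z
  set c := x * y * e - z ^ 2
  set d := spaceCurveGenerator x y z e
  have ha : a ∈ spaceCurveIdeal x y z e := fst_mem_spaceCurveIdeal x y z e
  have hb : b ∈ spaceCurveIdeal x y z e := snd_mem_spaceCurveIdeal x y z e
  have hc : c ∈ spaceCurveIdeal x y z e := thd_mem_spaceCurveIdeal x y z e
  have hdx : d * x = b * b - a * c := by grind [spaceCurveGenerator]
  have hdy : d * y = b * c + e * (a * a) := by grind [spaceCurveGenerator]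
  have hdz : d * z = c * c + e * (a * b) := by grind [spaceCurveGenerator]
  rw [Ideal.span_mul_span', Set.singleton_mul, Set.image_insert_eq, Set.image_pair, Ideal.span_le,
    hdx, hdy, hdz, pow_two]
  rintro _ (rfl | rfl | rfl)
  · exact sub_mem (Ideal.mul_mem_mul hb hb) (Ideal.mul_mem_mul ha hc)
  · exact add_mem (Ideal.mul_mem_mul hb hc) (Ideal.mul_mem_left _ e (Ideal.mul_mem_mul ha ha))
  · exact add_mem (Ideal.mul_mem_mul hc hc) (Ideal.mul_mem_left _ e (Ideal.mul_mem_mul ha hb))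

theorem spaceCurveIdeal_le_span : spaceCurveIdeal x y z e ≤ Ideal.span {x, y, z} := by
  have hx : x ∈ Ideal.span {x, y, z} := Ideal.subset_span (by simp)
  have hy : y ∈ Ideal.span {x, y, z} := Ideal.subset_span (by simp)
  have hz : z ∈ Ideal.span {x, y, z} := Ideal.subset_span (by simp)
  rw [spaceCurveIdeal, Ideal.span_le]
  rintro _ (rfl | rfl | rfl)
  · exact sub_mem (Ideal.mul_mem_left _ x hz) (Ideal.pow_mem_of_mem _ hy 2 two_pos)
  · exact sub_mem (Ideal.mul_mem_right e _ (Ideal.pow_mem_of_mem _ hx 2 two_pos))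
      (Ideal.mul_mem_left _ y hz)
  · exact sub_mem (Ideal.mul_mem_right e _ (Ideal.mul_mem_left _ x hy))
      (Ideal.pow_mem_of_mem _ hz 2 two_pos)

theorem radical_spaceCurveIdeal_sup_span_singleton :
    (spaceCurveIdeal x y z e ⊔ Ideal.span {x}).radical = (Ideal.span {x, y, z}).radical := by
  refine le_antisymm (Ideal.radical_mono (sup_le (spaceCurveIdeal_le_span x y z e)
    (Ideal.span_mono (by simp)))) (Ideal.radical_le_radical_iff.mpr ?_)
  set K := spaceCurveIdeal x y z e ⊔ Ideal.span {x}
  have hx : x ∈ K := Ideal.mem_sup_right (Ideal.mem_span_singleton_self x)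
  have hy : y ^ 2 ∈ K := by
    rw [← sub_sub_self (x * z) (y ^ 2)]
    exact sub_mem (K.mul_mem_right z hx) (Ideal.mem_sup_left (fst_mem_spaceCurveIdeal x y z e))
  have hz : z ^ 2 ∈ K := by
    rw [← sub_sub_self (x * y * e) (z ^ 2)]
    exact sub_mem (K.mul_mem_right e (K.mul_mem_right y hx))
      (Ideal.mem_sup_left (thd_mem_spaceCurveIdeal x y z e))
  exact Ideal.span_le.mpr (Set.insert_subset (Ideal.le_radical hx)
    (Set.pair_subset ⟨2, hy⟩ ⟨2, hz⟩))

variable {x y z e}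

theorem isSMulRegular_quotient_spaceCurveIdeal
    (hx : IsSMulRegular (R ⧸ Ideal.span {x * z - y ^ 2}) x)
    (hz : IsSMulRegular (R ⧸ Ideal.span {x} ⊔ Ideal.span {y}) z) :
    IsSMulRegular (R ⧸ spaceCurveIdeal x y z e) x := by
  rw [← Ideal.span_insert] at hz
  set a := x * z - y ^ 2 with ha
  set b := x ^ 2 * e - y * z with hb
  set c := x * y * e - z ^ 2 with hc
  have hyb : y * b = z * a + x * c := by grind
  have hyc : y * c = z * b - x * e * a := by grind
  have hcreg : IsSMulRegular (R ⧸ Ideal.span {x, y}) c :=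
    isSMulRegular_quotient_of_pow_sub_mul_mem (k := 2) (t := -1) hz
      (Ideal.mem_span_pair.mpr ⟨y * e, 0, by linear_combination -hc⟩)
  have mem_xy {r : R} (p q : R) (h : p * x + q * y = c * r) : ∃ α β, α * x + β * y = r :=
    Ideal.mem_span_pair.mp
      (mem_of_isSMulRegular_quotient_of_smul_mem hcreg (Ideal.mem_span_pair.mpr ⟨p, q, h⟩))
  have mem_a {w : R} (p : R) (h : x * w = a * p) : ∃ q, w = a * q :=
    Ideal.mem_span_singleton.mp (mem_of_isSMulRegular_quotient_of_smul_mem hx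
      (Ideal.mem_span_singleton.mpr ⟨p, h⟩))
  refine (isSMulRegular_quotient_iff_mem_of_smul_mem _ _).mpr fun w hw ↦ ?_
  obtain ⟨p, q, r, hpqr⟩ := Submodule.mem_span_triple.mp hw
  -- The syzygies `hyb` and `hyc` of `a, b, c` absorb first `r` and then `q`.
  have hxw : p * a + q * b + r * c = x * w := hpqr
  obtain ⟨α, β, hr⟩ := mem_xy (r := r) (w - p * z - q * x * e) (p * y + q * z)
    (by linear_combination -hxw + p * ha + q * hb)
  have hxw' : x * (w - α * c + β * e * a) = p * a + (q + β * z) * b := by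
    linear_combination -hxw - c * hr + β * hyc
  obtain ⟨κ, hκ⟩ := mem_a (w := y * (w - α * c + β * e * a) - (q + β * z) * c)
    (y * p + (q + β * z) * z) (by linear_combination y * hxw' + (q + β * z) * hyb)
  obtain ⟨γ, δ, hq⟩ := mem_xy (r := q + β * z) (-κ * z) (w - α * c + β * e * a + κ * y)
    (by linear_combination hκ + κ * ha)
  obtain ⟨μ, hμ⟩ := mem_a (w := w - α * c + β * e * a - γ * b - δ * c) (p + δ * z)
    (by linear_combination hxw' - b * hq + δ * hyb)
  refine Submodule.mem_span_triple.mpr ⟨μ - β * e, γ, α + δ, ?_⟩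
  simp only [smul_eq_mul]
  linear_combination -hμ

theorem isWeaklyRegular_of_perm_spaceCurveGenerator [IsLocalRing R] [IsNoetherianRing R]
    (hle : Ideal.span {x, y, z} ≤ maximalIdeal R) (hreg : IsWeaklyRegular R [x, y, z]) {l : List R}
    (hl : [x, x * z - y ^ 2, spaceCurveGenerator x y z e].Perm l) : IsWeaklyRegular R l := by
  have hx : x ∈ maximalIdeal R := hle (Ideal.subset_span (by simp))
  have hy : y ∈ maximalIdeal R := hle (Ideal.subset_span (by simp))
  have hz : z ∈ maximalIdeal R := hle (Ideal.subset_span (by simp))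
  have ha : x * z - y ^ 2 ∈ maximalIdeal R :=
    hle (spaceCurveIdeal_le_span x y z e (fst_mem_spaceCurveIdeal x y z e))
  have hd : spaceCurveGenerator x y z e ∈ maximalIdeal R :=
    hle (spaceCurveIdeal_le_span x y z e (spaceCurveGenerator_mem x y z e))
  have hpair {f g r : R} : r ∈ Ideal.ofList [f, g] ↔ ∃ s t, s * f + t * g = r := by
    rw [Ideal.ofList_cons, Ideal.ofList_singleton, ← Ideal.span_insert, Ideal.mem_span_pair]
  have hxzy : IsWeaklyRegular R ([x, z] ++ [y]) :=
    isWeaklyRegular_of_perm_of_subset_maximalIdeal hreg (.cons x (.swap z y []))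
      (by simp [-mem_maximalIdeal, hx, hy, hz])
  have hxza : IsWeaklyRegular R ([x, z] ++ [x * z - y ^ 2]) :=
    isWeaklyRegular_concat_of_pow_sub_mul_mem (k := 2) (t := -1) hxzy <|
      hpair.mpr ⟨z, 0, by ring⟩
  have hxaz : IsWeaklyRegular R ([x, x * z - y ^ 2] ++ [z]) :=
    isWeaklyRegular_of_perm_of_subset_maximalIdeal hxza (.cons x (.swap _ z []))
      (by simp [-mem_maximalIdeal, hx, ha, hz])
  have hxad : IsWeaklyRegular R ([x, x * z - y ^ 2] ++ [spaceCurveGenerator x y z e]) :=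
    isWeaklyRegular_concat_of_pow_sub_mul_mem (k := 3) (t := 1) hxaz <|
      hpair.mpr ⟨2 * y * z * e - x ^ 2 * e ^ 2, y * e, by rw [spaceCurveGenerator]; ring⟩
  exact isWeaklyRegular_of_perm_of_subset_maximalIdeal hxad hl
    (by simp [-mem_maximalIdeal, hx, ha, hd])

end SpaceCurve

theorem theorem5p9_general {R : Type*} [CommRing R] [IsLocalRing R] [IsNoetherianRing R]
    {x y z : R} (hreg : IsWeaklyRegular R [x, y, z])
    (hrad : (Ideal.span {x, y, z}).radical = maximalIdeal R) (e : R) (n : ℕ) :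
    0 < localDepth R (R ⧸ (minorsIdeal 2 !![x, y, z; y, z, x * e] ^ n).colon
        ((Ideal.span {x, y, z} ^ (n / 2) : Ideal R) : Set R)) ∧
      symbolicPower (minorsIdeal 2 !![x, y, z; y, z, x * e]) n =
        (minorsIdeal 2 !![x, y, z; y, z, x * e] ^ n).colon
          ((Ideal.span {x, y, z} ^ (n / 2) : Ideal R) : Set R) := by
  have hle : Ideal.span {x, y, z} ≤ maximalIdeal R := hrad ▸ Ideal.le_radical
  have hxm : x ∈ Ideal.span {x, y, z} := Ideal.subset_span (by simp)
  obtain ⟨ha, hda, hxad⟩ := isWeaklyRegular_triple_iff.mp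
    (isWeaklyRegular_of_perm_spaceCurveGenerator (e := e) hle hreg
      ((List.Perm.swap ..).trans (.cons _ (.swap ..))))
  obtain ⟨-, hxa, -⟩ := isWeaklyRegular_triple_iff.mp
    (isWeaklyRegular_of_perm_spaceCurveGenerator (e := e) hle hreg (.swap ..))
  have hxI := isSMulRegular_quotient_spaceCurveIdeal (e := e) hxa
    (isWeaklyRegular_triple_iff.mp hreg).2.2
  have hxJ := isSMulRegular_quotient_degreeTwoFiltration (fst_mem_spaceCurveIdeal x y z e)
    (spaceCurveGenerator_mem x y z e) (spaceCurveIdeal_sq_le x y z e) ha hda hxad hxI n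
  have hdm := span_spaceCurveGenerator_mul_le x y z e
  rw [minorsIdeal_eq_spaceCurveIdeal, ← degreeTwoFiltration_eq_colon hdm hxm hxJ]
  refine ⟨localDepth_pos_of_isSMulRegular (hle hxm) hxJ, symbolicPower_eq_of_isSMulRegular
    ((radical_spaceCurveIdeal_sup_span_singleton x y z e).trans hrad) hxI hxJ
    (pow_le_degreeTwoFiltration n) (k := n / 2) fun s hs ↦ ?_⟩
  rw [mul_comm]
  exact degreeTwoFiltration_mul_pow_le hdm n (Ideal.mul_mem_mul hs (Ideal.pow_mem_pow hxm _))

theorem theorem5p9 {R : Type*} [CommRing R] [IsRegularLocalRing R]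
    (hdim : ringKrullDim R = 3) (x y z : R)
    (hxyz : IsLocalRing.maximalIdeal R = Ideal.span {x, y, z})
    (I : Ideal R) (hI : I = minorsIdeal 2 !![x, y, z; y, z, x ^ 2])
    (n : ℕ) (hn : 1 ≤ n) (q : ℕ) (hq : q = n / 2) :
    0 < localDepth R (R ⧸ (I ^ n).colon ((IsLocalRing.maximalIdeal R ^ q : Ideal R) : Set R)) ∧
      symbolicPower I n =
        (I ^ n).colon ((IsLocalRing.maximalIdeal R ^ q : Ideal R) : Set R) := by
  have hl : Ideal.ofList [x, y, z] = maximalIdeal R := by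
    rw [hxyz, Ideal.ofList]; congr 1; ext; simp
  have hreg := isWeaklyRegular_of_ofList_eq_maximalIdeal hl (by simp [hdim])
  have hrad : (Ideal.span {x, y, z}).radical = maximalIdeal R := by
    rw [← hxyz, (maximalIdeal.isMaximal R).isPrime.radical]
  rw [hI, hq, hxyz, pow_two]
  exact theorem5p9_general hreg hrad x n
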